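/- **Differential privacy.** A database of size $n$ is a tuple of $n$ records in $\mathbb R^2$; two databases of the same size are neighbouring if they differ in at most one record. A randomized algorithm $M$ is $(\epsilon,\delta)$-differentially private if $P(M(D)\in S)\le e^{\epsilon}P(M(\hat D)\in S)+\delta$ for all neighbouring $D,\hat D$ (of any size) and all measurable $S$. **SGLD.** Consider Bayesian linear regression $y=\theta x+\xi$, $\xi\sim\mathcal N(0,\beta^{-1})$, with prior $\theta\sim\mathcal N(0,\alpha^{-1})$. Running (cyclic, batch size one) SGLD with step size $\eta$ for $T$ steps on a finite set $W$ of records means: draw a uniformly random order of the $|W|$ records, draw $\theta_0\sim\mathcal N(0,\alpha^{-1})$, and for $0\le j<T$ put $$\theta_{j+1}=\theta_j+\tfrac{\eta}{2}\bigl[\nabla\ln p(\theta_j)+|W|\,\nabla_{\theta}\ln p(y\mid x,\theta_j)\bigr]+\sqrt{\eta}\,\xi_j,\qquad \xi_j\sim\mathcal N(0,1)\text{ independent},$$ where $(x,y)$ is the record used at step $j$, the records being visited cyclically in the chosen order (the likelihood term is absent if $W=\emptyset$). The output is $\theta_T$. **Algorithm.** Parameters: $\epsilon_0>0$, $0<\delta_0<\frac12$,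 $0<x_l<x_h$, $\alpha>0$, $\beta\ge 3/x_h^2$, $\rho_1\in(1,\frac32)$, $\rho_2\in(0,\frac12)$, $\gamma_1\in(\rho_2,\frac12)$. On input $D=\{(x_i,y_i)\}_{i=1}^{n_1}$, with independent Laplace draws and $\tau=\frac1{\epsilon_0}\log\frac1{2\delta_0}$ (the power $t^a$ of a negative noisy quantity $t$, namely of $\breve n_1$ or $\breve m$, being read as $0$): 1. Replace $x_i$ by $\min\{\max\{x_i,x_l\},x_h\}$ and $y_i$ by $\max\{y_i,0\}$. 2. $\breve n_1=n_1-\tau+\mathrm{Lap}(\frac1{\epsilon_0})$; $V=\{i: y_i/x_i\le\breve n_1^{\rho_1}\}$; $n_2=|V|-\tau+\mathrm{Lap}(\frac1{\epsilon_0})$. If $n_2\le1$, return null. 3. $m=\sum_{V}x_iy_i\big/\sum_{V}x_i^2$ (with $m=0$ if $V=\emptyset$); $\breve m=m+\mathrm{Lap}\Bigl(\frac1{\epsilon_0}\breve n_1^{\rho_1}\frac{2(n_2-1)x_h^2x_l^2+x_h^4}{n_2(n_2-1)x_l^4}\Bigr)$. 4. $W=\{i:|y_i/x_i-\breve m|\le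 n_2^{\rho_2}\}$; $n_W=|W|-\tau+\mathrm{Lap}(\frac1{\epsilon_0})$. If $n_W<n_{\min}$, return null. 5. Run SGLD on the records in $W$ with step size $\eta=\frac1{(\alpha+n_1x_h^2\beta)^2}$ for $T$ steps and return $\theta_T$ (in place of a sample from the posterior $p(\theta\mid W)$). Here, with $\nu=\frac{2\ln(1/\delta_0)}{\epsilon_0}+1$, $\kappa_1=\frac{(x_h^2\beta)(x_h^2\alpha+x_h^4\beta)}{\frac9{10}(x_l^2\beta)^2}$, $\kappa_2=\frac{(x_h^2\alpha+x_h^4\beta)^2}{\frac9{10}x_l^6\beta}$, the number $n_{\min}$ is the maximum of $1+\frac{x_h^2}{x_l^2}\frac8{\epsilon_0}$, $\;1+\nu\frac{x_h^2}{x_l^2}\bigl(1+\frac{8(\nu-1)}{\epsilon_0}\bigr)$, $\;\bigl(\frac{16\nu\beta x_h^4}{\frac9{10}\epsilon_0x_l^2}\bigr)^{\frac1{1-2\gamma_1}}$, $\;\bigl(\frac{32\nu\beta}{\epsilon_0}\kappa_1\breve m\bigr)^{\frac1{2-\gamma_1}}$, $\;\bigl(\frac{32\nu\beta}{\epsilon_0}\kappa_1\bigr)^{\frac1{2-2\gamma_1}}$,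 $\;\bigl(\frac{8\nu}{\epsilon_0}\kappa_2\breve m\bigr)^{\frac23}$, $\;\bigl(\frac{8\nu}{\epsilon_0}\kappa_2\bigr)^{\frac1{3-2\gamma_1}}$, $\;1+\frac{x_h^2}{x_l^2}\frac{10\nu}{\beta}$, $\;1+\nu\frac{x_h^2}{x_l^2}$, $\;n_1^{\rho_2/\gamma_1}$. **Claim.** Suppose in addition that $\rho_1<1+\rho_2$ and $x_l\le x_h/2$, and let $1<\rho_3<\rho_1$. For every $\epsilon>0$ and $\delta<\frac16$ there is a positive integer $T$ such that the algorithm above, run with $T$ SGLD steps, is not $(\epsilon,\delta)$-differentially private. This is witnessed as follows. Let $D_3$ consist of $n_1$ copies of $(x_h,\,n_1^{\rho_3}x_h)$, and let $D_4$ be $D_3$ with its last record replaced by $(\frac{x_h}2,\,n_1^{\rho_3}\frac{x_h}2)$. Then $D_3$ and $D_4$ are neighbouring; on each of them the probability that the algorithm reaches step 5 with $W$ containing all records tends to $1$ as $n_1\to\infty$; and there are a constant $C>0$ and numbers of steps $T(n_1)\ge1$, independent of $\delta$, such that for every $\delta<\frac16$ and all sufficiently large $n_1$ there is a measurable set $S$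 of outputs for which the algorithm $M$ with $T(n_1)$ steps satisfies $$P(M(D_3)\in S)>e^{C\,n_1^{2\rho_3-2}}\,P(M(D_4)\in S)+\delta .$$ -/

import Mathlib

open MeasureTheory ProbabilityTheory Filter Topology

noncomputable section

namespace ProposeTestSample

/-! ### Differential privacy -/

/-- A database of size `n`: a family of `n` records `(x_i, y_i)`. -/
abbrev Database (n : ℕ) : Type := Fin n → ℝ × ℝ

/-- A randomized algorithm, given by the law `M n D` of its output on every database `D` of every
size `n`, is `(ε, δ)`-differentially private: `P(M(D) ∈ S) ≤ exp(ε) P(M(D') ∈ S) + δ` for all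
measurable `S` and all neighbouring databases (same size, Hamming distance at most one). -/
def IsDifferentiallyPrivate {R : Type*} [MeasurableSpace R]
    (M : (n : ℕ) → Database n → Measure R) (ε δ : ℝ) : Prop :=
  ∀ (n : ℕ) (D D' : Database n), hammingDist D D' ≤ 1 →
    ∀ S : Set R, MeasurableSet S → (M n D).real S ≤ Real.exp ε * (M n D').real S + δ

/-! ### The Laplace distribution -/

/-- The Laplace distribution `Lap(1)`, with density `exp(-|x|) / 2`. If `ℓ` has this law then
`b * ℓ` has law `Lap(b)`, and `Lap(0)` is the point mass at `0`. -/
def stdLaplace : Measure ℝ :=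
  volume.withDensity fun x => ENNReal.ofReal (Real.exp (-|x|) / 2)

instance instIsProbabilityMeasureStdLaplace : IsProbabilityMeasure stdLaplace := by
  have hint : ∫ x : ℝ, Real.exp (-|x|) = 2 := by
    have h := integral_comp_abs (f := fun x : ℝ => Real.exp (-x))
    simp only [integral_exp_neg_Ioi_zero, mul_one] at h
    exact h
  have hi : Integrable (fun x : ℝ => Real.exp (-|x|)) := by
    by_contra hc
    rw [integral_undef hc] at hint
    norm_num at hint
  constructor
  rw [stdLaplace, withDensity_apply _ MeasurableSet.univ, Measure.restrict_univ,
    ← ofReal_integral_eq_lintegral_ofReal (hi.div_const 2)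
      (Eventually.of_forall fun x => by positivity),
    integral_div, hint]
  norm_num

/-! ### Cyclic SGLD with batch size one for Bayesian linear regression -/

/-- Logarithm of the density of the prior `θ ∼ N(0, α⁻¹)`. -/
def logPrior (α θ : ℝ) : ℝ :=
  -(α * θ ^ 2 / 2) - 1 / 2 * Real.log (2 * Real.pi / α)

/-- Logarithm of the likelihood of a record `z = (x, y)`, where `y = θ x + ξ`, `ξ ∼ N(0, β⁻¹)`. -/
def logLikelihood (β : ℝ) (z : ℝ × ℝ) (θ : ℝ) : ℝ :=
  -(β * (z.2 - θ * z.1) ^ 2 / 2) - 1 / 2 * Real.log (2 * Real.pi / β)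

/-- The noiseless part of the `j`-th SGLD step (`j = 0, 1, …`) with step size `η`, for the records
`d : ι → ℝ × ℝ` visited cyclically in the order `σ`:
`θ + (η / 2) (∇ log p(θ) + m ∇ log p(y | x, θ))`, where `m` is the number of records and `(x, y)` is
the record in position `j mod m` of the order. If there are no records, only the prior enters. -/
def sgldDrift {ι : Type} [Fintype ι] (α β η : ℝ) (d : ι → ℝ × ℝ)
    (σ : Fin (Fintype.card ι) ≃ ι) (j : ℕ) (θ : ℝ) : ℝ :=
  θ + η / 2 * (deriv (logPrior α) θ +
    if h : 0 < Fintype.card ι then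
      (Fintype.card ι : ℝ) *
        deriv (logLikelihood β (d (σ ⟨j % Fintype.card ι, Nat.mod_lt j h⟩))) θ
    else 0)

/-- The law of the cyclic SGLD iterate `θ_j` for the fixed order `σ`: `θ_0` is drawn from the prior
`N(0, α⁻¹)` and `θ_{j+1} = sgldDrift θ_j + √η ξ_j` with an independent `ξ_j ∼ N(0, 1)`; adding
independent noise is convolution with `N(0, η)`. -/
def cyclicSGLDLaw {ι : Type} [Fintype ι] (α β η : ℝ) (d : ι → ℝ × ℝ)
    (σ : Fin (Fintype.card ι) ≃ ι) : ℕ → Measure ℝ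
  | 0 => gaussianReal 0 (Real.toNNReal α⁻¹)
  | j + 1 => ((cyclicSGLDLaw α β η d σ j).map (sgldDrift α β η d σ j)).conv
      (gaussianReal 0 (Real.toNNReal η))

open Classical in
/-- The law of the output of `T` steps of cyclic SGLD: the records are first shuffled uniformly at
random, i.e. one of the finitely many orders is chosen uniformly. -/
def sgldLaw {ι : Type} [Fintype ι] (α β η : ℝ) (d : ι → ℝ × ℝ) (T : ℕ) : Measure ℝ :=
  (Fintype.card (Fin (Fintype.card ι) ≃ ι) : ENNReal)⁻¹ •
    ∑ σ : Fin (Fintype.card ι) ≃ ι, cyclicSGLDLaw α β η d σ T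

/-! ### The Propose-Test-Sample algorithm -/

/-- The parameters of the algorithm, with their admissible ranges. -/
structure Params where
  /-- The privacy parameter `ε` used inside the algorithm. -/
  ε : ℝ
  /-- The privacy parameter `δ` used inside the algorithm. -/
  δ : ℝ
  /-- Lower clipping bound for `x`. -/
  xl : ℝ
  /-- Upper clipping bound for `x`. -/
  xh : ℝ
  /-- Precision of the prior. -/
  α : ℝ
  /-- Precision of the observation noise. -/
  β : ℝ
  ρ₁ : ℝ
  ρ₂ : ℝ
  γ₁ : ℝ
  ε_pos : 0 < ε
  δ_pos : 0 < δ
  δ_lt : δ < 1 / 2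
  xl_pos : 0 < xl
  xl_lt : xl < xh
  α_pos : 0 < α
  β_ge : 3 / xh ^ 2 ≤ β
  ρ₁_gt : 1 < ρ₁
  ρ₁_lt : ρ₁ < 3 / 2
  ρ₂_pos : 0 < ρ₂
  ρ₂_lt : ρ₂ < 1 / 2
  γ₁_gt : ρ₂ < γ₁
  γ₁_lt : γ₁ < 1 / 2

namespace Params

variable (p : Params)

/-- Clipping of a record: `x` to `[xl, xh]`, `y` to `[0, ∞)`. -/
def clip (z : ℝ × ℝ) : ℝ × ℝ := (min (max z.1 p.xl) p.xh, max z.2 0)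

/-- The offset `(1 / ε) log (1 / (2 δ))` of the noisy counts. -/
def offset : ℝ := 1 / p.ε * Real.log (1 / (2 * p.δ))

/-- The noisy size `n̆₁` of a database of size `n₁`; `ℓ` is a draw from `Lap(1)`. -/
def nBreve (n₁ : ℕ) (ℓ : ℝ) : ℝ := n₁ - p.offset + 1 / p.ε * ℓ

/-- The bound `n̆₁ ^ ρ₁` on the slopes, a negative `n̆₁` being read as `0`. -/
def slopeBound (n₁ : ℕ) (ℓ : ℝ) : ℝ := (max (p.nBreve n₁ ℓ) 0) ^ p.ρ₁

/-- The (indices of the) records of `D` whose slope is at most `b`. -/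
def V {n₁ : ℕ} (D : Database n₁) (b : ℝ) : Finset (Fin n₁) :=
  {i | (D i).2 / (D i).1 ≤ b}

/-- A noisy count of the elements of a set of records; `ℓ` is a draw from `Lap(1)`. -/
def noisyCard {n₁ : ℕ} (s : Finset (Fin n₁)) (ℓ : ℝ) : ℝ := s.card - p.offset + 1 / p.ε * ℓ

/-- The least squares slope of the records in `s`. -/
def slope {n₁ : ℕ} (D : Database n₁) (s : Finset (Fin n₁)) : ℝ :=
  (∑ i ∈ s, (D i).1 * (D i).2) / ∑ i ∈ s, (D i).1 ^ 2

/-- The scale of the Laplace noise that is added to the slope; `b` stands for `n̆₁ ^ ρ₁`. -/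
def slopeScale (b n₂ : ℝ) : ℝ :=
  1 / p.ε * b * ((2 * (n₂ - 1) * p.xh ^ 2 * p.xl ^ 2 + p.xh ^ 4) / (n₂ * (n₂ - 1) * p.xl ^ 4))

/-- The (indices of the) records of `D` whose slope is within `n₂ ^ ρ₂` of `m`. -/
def W {n₁ : ℕ} (D : Database n₁) (n₂ m : ℝ) : Finset (Fin n₁) :=
  {i | |(D i).2 / (D i).1 - m| ≤ n₂ ^ p.ρ₂}

/-- The order `ν = 2 log(1 / δ) / ε + 1` of the Rényi divergence in `nMin`. -/
def ν : ℝ := 2 * Real.log (1 / p.δ) / p.ε + 1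

/-- The constant `(x_h² β) (x_h² α + x_h⁴ β) / ((9 / 10) (x_l² β)²)` in `nMin`. -/
def κ₁ : ℝ :=
  (p.xh ^ 2 * p.β) * (p.xh ^ 2 * p.α + p.xh ^ 4 * p.β) / (9 / 10 * (p.xl ^ 2 * p.β) ^ 2)

/-- The constant `(x_h² α + x_h⁴ β)² / ((9 / 10) x_l⁶ β)` in `nMin`. -/
def κ₂ : ℝ := (p.xh ^ 2 * p.α + p.xh ^ 4 * p.β) ^ 2 / (9 / 10 * p.xl ^ 6 * p.β)

/-- The seven-fold maximum `n_{b1}`, as a function of the noisy slope `m`; a negative `m` is read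
as `0` where a real power of it is taken. -/
def nb1 (m : ℝ) : ℝ :=
  max (1 + p.xh ^ 2 / p.xl ^ 2 * (8 / p.ε)) <|
  max (1 + p.ν * (p.xh ^ 2 / p.xl ^ 2) * (1 + 8 * ((p.ν - 1) / p.ε))) <|
  max ((16 * p.ν * p.β * p.xh ^ 4 / (9 / 10 * p.ε * p.xl ^ 2)) ^ (1 / (1 - 2 * p.γ₁))) <|
  max ((32 * p.ν * p.β / p.ε * p.κ₁ * max m 0) ^ (1 / (2 - p.γ₁))) <|
  max ((32 * p.ν * p.β / p.ε * p.κ₁) ^ (1 / (2 - 2 * p.γ₁))) <|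
  max ((8 * p.ν / p.ε * p.κ₂ * max m 0) ^ (2 / 3 : ℝ)) <|
  (8 * p.ν / p.ε * p.κ₂) ^ (1 / (3 - 2 * p.γ₁))

/-- The maximum `n_{b2}`. -/
def nb2 : ℝ :=
  max (1 + p.xh ^ 2 / p.xl ^ 2 * (10 * p.ν / p.β)) (1 + p.ν * (p.xh ^ 2 / p.xl ^ 2))

/-- The threshold `n_min` of the last test. -/
def nMin (n₁ : ℕ) (m : ℝ) : ℝ :=
  max (p.nb1 m) (max p.nb2 ((n₁ : ℝ) ^ (p.ρ₂ / p.γ₁)))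

/-- The propose and test phases on the clipped database `D`, as a function of four independent
draws `ℓ 0, …, ℓ 3` from `Lap(1)`. The result is `none` if the algorithm returns null, and
`some W` if it reaches the sampling step with the set `W` of records. -/
def testPhase {n₁ : ℕ} (D : Database n₁) (ℓ : Fin 4 → ℝ) : Option (Finset (Fin n₁)) :=
  let b := p.slopeBound n₁ (ℓ 0)
  let V := V D b
  let n₂ := p.noisyCard V (ℓ 1)
  if n₂ ≤ 1 then none
  else
    let m := slope D V + p.slopeScale b n₂ * ℓ 2
    let W := p.W D n₂ m
    if p.noisyCard W (ℓ 3) < p.nMin n₁ m then none else some W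

/-- The law of the four Laplace draws. -/
def testNoise : Measure (Fin 4 → ℝ) := Measure.pi fun _ => stdLaplace

/-- The probability that the algorithm, run on `D`, reaches the sampling step with all the records
of (the clipped version of) `D` in `W`. -/
def passProb {n₁ : ℕ} (D : Database n₁) : ℝ :=
  testNoise.real {ℓ | p.testPhase (fun i => p.clip (D i)) ℓ = some Finset.univ}

/-- The step size `1 / (α + n₁ x_h² β)²`. -/
def stepSize (n₁ : ℕ) : ℝ := 1 / (p.α + n₁ * p.xh ^ 2 * p.β) ^ 2

/-- The law of the output of the Propose-Test-Sample algorithm in which the final posterior sample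
is replaced by the result of `T` steps of cyclic SGLD on `W`. The output null is `Sum.inl ()`, the
output `θ` is `Sum.inr θ`. -/
def sgldAlgorithm (T n₁ : ℕ) (D : Database n₁) : Measure (Unit ⊕ ℝ) :=
  let D' : Database n₁ := fun i => p.clip (D i)
  testNoise.bind fun ℓ =>
    match p.testPhase D' ℓ with
    | none => Measure.dirac (Sum.inl ())
    | some W =>
      (sgldLaw p.α p.β (p.stepSize n₁) (fun i : W => D' i) T).map Sum.inr

/-! ### The two neighbouring databases -/

/-- The database `D₃`: `n₁` copies of the record `(x_h, n₁ ^ ρ₃ x_h)`. -/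
def D₃ (ρ₃ : ℝ) (n₁ : ℕ) : Database n₁ := fun _ => (p.xh, (n₁ : ℝ) ^ ρ₃ * p.xh)

/-- The database `D₄`: `D₃` with the last record replaced by `(x_h / 2, n₁ ^ ρ₃ x_h / 2)`. -/
def D₄ (ρ₃ : ℝ) (n₁ : ℕ) : Database n₁ := fun i =>
  if (i : ℕ) + 1 = n₁ then (p.xh / 2, (n₁ : ℝ) ^ ρ₃ * (p.xh / 2)) else p.D₃ ρ₃ n₁ i

end Params

end ProposeTestSample

end

noncomputable section

namespace ProposeTestSample

/-! ### Gaussian tails -/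

/-! In both databases every record has the same slope `c = n ^ ρ₃`, so an SGLD step is affine and
contracts `θ` towards (nearly) `c`. For a fixed visiting order each iterate is therefore exactly
Gaussian (`cyclicSGLDLaw_eq_gaussianReal`), and only its mean and variance matter. The chain is
stopped after one epoch, `T = n`, long before convergence. A step contracts by `1 - O(1/n)`, so the
deviation from `c` is still of order `c`. The one record with covariate `x_h / 2` contracts less, by
an amount of order `1/n`, which leaves a difference of means of order `c / n = n ^ (ρ₃ - 1)`,
wherever the record stands in the order (`le_sgldError`, `le_meanGap`). The variance stays below
`α⁻¹ + 1`.

Take `S` to be the half-line above the mean for `D₃`. It has mass at least `1/2` under SGLD on `D₃`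
(`half_le_sgldLaw`) and at most `exp(-const * n ^ (2 ρ₃ - 2))` under SGLD on `D₄`
(`sgldLaw_le_exp`).

The test phase does not spoil this. A common slope makes `W` either everything or empty. Passing the
last test with `W` empty needs a Laplace draw of size `ε n ^ (ρ₂ / γ₁)`
(`testNoise_testPhase_eq_some_empty_le`), and this is rarer than the Gaussian tail because `2 ρ₃ - 2
< 2 ρ₂ < ρ₂ / γ₁`. Conversely, any fixed noise draw passes with `W` full once `n` is large, so the
passing probability tends to `1` (`eventually_testPhase_eq`, `tendsto_passProb`).
`exists_sgldAlgorithm_gap` combines these estimates. -/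

/-- The reflection `x ↦ 2 m - x` preserves the law and swaps the two closed half-lines at `m`, which
cover the line. The degenerate case `v = 0` is included. -/
theorem half_le_gaussianReal_Ici (m : ℝ) (v : NNReal) :
    1 / 2 ≤ (gaussianReal m v).real (Set.Ici m) := by
  have hmap : (gaussianReal m v).map (fun x => 2 * m - x) = gaussianReal m v := by
    rw [gaussianReal_map_const_sub]
    ring_nf
  have hsymm : (gaussianReal m v).real (Set.Iic m) = (gaussianReal m v).real (Set.Ici m) := by
    conv_rhs => rw [← hmap]
    rw [map_measureReal_apply (by fun_prop) measurableSet_Ici]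
    congr 1
    ext x
    simp only [Set.mem_Iic, Set.mem_preimage, Set.mem_Ici]
    constructor <;> intro h <;> linarith
  have hunion := measureReal_union_le (μ := gaussianReal m v) (Set.Iic m) (Set.Ici m)
  rw [Set.Iic_union_Ici, probReal_univ, hsymm] at hunion
  linarith

/-- Chernoff's bound with parameter `d / V`, optimal for variance `V`. Since only an upper bound on
the variance enters, the exact variance of the SGLD iterate need not be known. -/
theorem gaussianReal_Ici_le {m a d V : ℝ} {v : NNReal} (hd : 0 ≤ d) (hV : 0 < V) (hv : v ≤ V)
    (ha : m + d ≤ a) : (gaussianReal m v).real (Set.Ici a) ≤ Real.exp (-(d ^ 2 / (2 * V))) := by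
  have h := measure_ge_le_exp_mul_mgf (μ := gaussianReal m v) (X := id) (t := d / V) a
    (by positivity) (integrable_exp_mul_gaussianReal (d / V))
  rw [mgf_id_gaussianReal] at h
  refine h.trans ?_
  rw [← Real.exp_add, Real.exp_le_exp]
  have h1 : d / V * (m + d) ≤ d / V * a := by gcongr
  have h2 : (v : ℝ) * (d / V) ^ 2 ≤ V * (d / V) ^ 2 := by gcongr
  have h3 : V * (d / V) ^ 2 = d * (d / V) := by field_simp
  have h4 : d ^ 2 / (2 * V) = d * (d / V) / 2 := by field_simp
  rw [h4]
  linarith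

/-! ### The law of cyclic SGLD on records with a common slope -/

theorem deriv_logPrior (α θ : ℝ) : deriv (logPrior α) θ = -(α * θ) := by
  have h : HasDerivAt (logPrior α) (-(α * (2 * θ) / 2)) θ := by
    unfold logPrior
    simpa using ((((hasDerivAt_pow 2 θ).const_mul α).div_const 2).neg).sub_const
      (1 / 2 * Real.log (2 * Real.pi / α))
  rw [h.deriv]
  ring

theorem deriv_logLikelihood (β : ℝ) (z : ℝ × ℝ) (θ : ℝ) :
    deriv (logLikelihood β z) θ = β * z.1 * (z.2 - θ * z.1) := by
  have h : HasDerivAt (logLikelihood β z) (-(β * (2 * (z.2 - θ * z.1) * (-z.1)) / 2)) θ := by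
    unfold logLikelihood
    have h0 : HasDerivAt (fun θ => z.2 - θ * z.1) (-z.1) θ := by
      simpa using ((hasDerivAt_id θ).mul_const z.1).const_sub z.2
    simpa using ((((h0.pow 2).const_mul β).div_const 2).neg).sub_const
      (1 / 2 * Real.log (2 * Real.pi / β))
  rw [h.deriv]
  ring

/-- The factor by which an SGLD step on a record with covariate `x`, out of `n` records, brings the
iterate closer to the slope of the record. -/
def shrinkage (α β η n x : ℝ) : ℝ := η / 2 * (α + n * β * x ^ 2)

/-- The expected deviation of the SGLD iterate from the common slope `c` of the records, when the
`j`-th step shrinks it by `s j`. -/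
def sgldError (α η c : ℝ) (s : ℕ → ℝ) : ℕ → ℝ
  | 0 => c
  | j + 1 => (1 - s j) * sgldError α η c s j + η / 2 * α * c

/-- Each step is the affine map `θ ↦ (1 - s j) θ + (s j c - η α c / 2)` followed by independent
Gaussian noise. The mean is tracked exactly. For the variance, a factor `(1 - s j) ^ 2 ≤ 1` is
dropped, so that each step adds at most `η`. -/
theorem cyclicSGLDLaw_eq_gaussianReal {ι : Type} [Fintype ι] (hι : 0 < Fintype.card ι)
    {α β η c : ℝ} (hα : 0 < α) (hη : 0 ≤ η) (d : ι → ℝ × ℝ) (hd : ∀ i, (d i).2 = c * (d i).1)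
    (σ : Fin (Fintype.card ι) ≃ ι) (s : ℕ → ℝ)
    (hs : ∀ j, s j = shrinkage α β η (Fintype.card ι)
      (d (σ ⟨j % Fintype.card ι, Nat.mod_lt j hι⟩)).1)
    (hs0 : ∀ j, 0 ≤ s j) (hs1 : ∀ j, s j ≤ 1) (j : ℕ) :
    ∃ v : NNReal, (v : ℝ) ≤ α⁻¹ + j * η ∧
      cyclicSGLDLaw α β η d σ j = gaussianReal (c - sgldError α η c s j) v := by
  induction j with
  | zero =>
    refine ⟨Real.toNNReal α⁻¹, ?_, ?_⟩
    · rw [Real.coe_toNNReal _ (by positivity)]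
      simp
    · simp [cyclicSGLDLaw, sgldError]
  | succ j ih =>
    obtain ⟨v, hv, hlaw⟩ := ih
    have hdrift : sgldDrift α β η d σ j =
        (fun θ => θ + (s j * c - η / 2 * α * c)) ∘ (fun θ => (1 - s j) * θ) := by
      funext θ
      simp only [sgldDrift, hι, dif_pos, deriv_logPrior, deriv_logLikelihood, hs, shrinkage, hd,
        Function.comp]
      ring
    refine ⟨⟨(1 - s j) ^ 2, sq_nonneg _⟩ * v + Real.toNNReal η, ?_, ?_⟩
    · have h1 : (1 - s j) ^ 2 ≤ 1 := by nlinarith [hs0 j, hs1 j]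
      have h2 : (1 - s j) ^ 2 * (v : ℝ) ≤ 1 * v := by gcongr
      push_cast
      rw [Real.coe_toNNReal _ hη]
      change (1 - s j) ^ 2 * (v : ℝ) + η ≤ _
      linarith
    · rw [cyclicSGLDLaw, hlaw, hdrift, ← Measure.map_map (by fun_prop) (by fun_prop),
        gaussianReal_map_const_mul, gaussianReal_map_add_const, gaussianReal_conv_gaussianReal]
      congr 1
      simp only [sgldError]
      ring

/-- The shuffled law is an average over orders, so bounds uniform in the order pass to it. -/
theorem le_sgldLaw {ι : Type} [Fintype ι] {α β η : ℝ} {d : ι → ℝ × ℝ} {T : ℕ} {S : Set ℝ}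
    {q : ENNReal} (h : ∀ σ, q ≤ cyclicSGLDLaw α β η d σ T S) : q ≤ sgldLaw α β η d T S := by
  classical
  have hne : (Fintype.card (Fin (Fintype.card ι) ≃ ι) : ENNReal) ≠ 0 := by
    have : Nonempty (Fin (Fintype.card ι) ≃ ι) := ⟨(Fintype.equivFin ι).symm⟩
    exact_mod_cast Fintype.card_ne_zero
  have hsum : (Fintype.card (Fin (Fintype.card ι) ≃ ι) : ENNReal) * q ≤
      ∑ σ, cyclicSGLDLaw α β η d σ T S := by
    have := Finset.sum_le_sum fun σ (_ : σ ∈ Finset.univ) => h σ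
    simpa [Finset.sum_const, nsmul_eq_mul] using this
  calc q = (Fintype.card (Fin (Fintype.card ι) ≃ ι) : ENNReal)⁻¹ *
        ((Fintype.card (Fin (Fintype.card ι) ≃ ι) : ENNReal) * q) := by
        rw [← mul_assoc, ENNReal.inv_mul_cancel hne (ENNReal.natCast_ne_top _), one_mul]
    _ ≤ (Fintype.card (Fin (Fintype.card ι) ≃ ι) : ENNReal)⁻¹ *
        ∑ σ, cyclicSGLDLaw α β η d σ T S := by gcongr
    _ = sgldLaw α β η d T S := by
        simp only [sgldLaw, Measure.smul_apply, Measure.coe_finsetSum, Finset.sum_apply,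
          smul_eq_mul]

theorem sgldLaw_le {ι : Type} [Fintype ι] {α β η : ℝ} {d : ι → ℝ × ℝ} {T : ℕ} {S : Set ℝ}
    {q : ENNReal} (h : ∀ σ, cyclicSGLDLaw α β η d σ T S ≤ q) : sgldLaw α β η d T S ≤ q := by
  classical
  have hne : (Fintype.card (Fin (Fintype.card ι) ≃ ι) : ENNReal) ≠ 0 := by
    have : Nonempty (Fin (Fintype.card ι) ≃ ι) := ⟨(Fintype.equivFin ι).symm⟩
    exact_mod_cast Fintype.card_ne_zero
  have hsum : ∑ σ, cyclicSGLDLaw α β η d σ T S ≤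
      (Fintype.card (Fin (Fintype.card ι) ≃ ι) : ENNReal) * q := by
    have := Finset.sum_le_sum fun σ (_ : σ ∈ Finset.univ) => h σ
    simpa [Finset.sum_const, nsmul_eq_mul] using this
  calc sgldLaw α β η d T S = (Fintype.card (Fin (Fintype.card ι) ≃ ι) : ENNReal)⁻¹ *
        ∑ σ, cyclicSGLDLaw α β η d σ T S := by
        simp only [sgldLaw, Measure.smul_apply, Measure.coe_finsetSum, Finset.sum_apply,
          smul_eq_mul]
    _ ≤ (Fintype.card (Fin (Fintype.card ι) ≃ ι) : ENNReal)⁻¹ *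
        ((Fintype.card (Fin (Fintype.card ι) ≃ ι) : ENNReal) * q) := by gcongr
    _ = q := by
        rw [← mul_assoc, ENNReal.inv_mul_cancel hne (ENNReal.natCast_ne_top _), one_mul]

/-- The expected deviation when every step has the same shrinkage `l`, where `η α / 2 = l r`. -/
theorem sgldError_const {α η c l r : ℝ} (h : η / 2 * α = l * r) (j : ℕ) :
    sgldError α η c (fun _ => l) j = c * (r + (1 - r) * (1 - l) ^ j) := by
  induction j with
  | zero => simp [sgldError]
  | succ j ih =>
    rw [sgldError, ih, h]
    ring

/-- A single step with the smaller shrinkage `l'` during the first `n` steps leaves a larger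
deviation. -/
theorem le_sgldError {α η c l l' r : ℝ} (h : η / 2 * α = l * r) (hc : 0 ≤ c) (hr0 : 0 ≤ r)
    (hr1 : r ≤ 1) (hl : l ≤ 1) (hll : l' ≤ l) {n k : ℕ} {s : ℕ → ℝ}
    (hs : ∀ j < n, s j = if j = k then l' else l) (j : ℕ) (hj : j ≤ n) :
    c * (r + (1 - r) * (1 - l) ^ j) +
        (if k < j then (1 - l) ^ (j - 1) * ((l - l') * (c * (1 - r))) else 0) ≤
      sgldError α η c s j := by
  have hl' : 0 ≤ 1 - l := by linarith
  have hr' : 0 ≤ 1 - r := by linarith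
  have hd : 0 ≤ l - l' := by linarith
  induction j with
  | zero => simp [sgldError]
  | succ j ih =>
    have ih := ih (by omega)
    rw [sgldError, hs j (by omega), h]
    rcases lt_trichotomy k j with hk | hk | hk
    · rw [if_pos hk] at ih
      rw [if_pos (by omega), if_neg (by omega)]
      have := mul_le_mul_of_nonneg_left ih hl'
      obtain ⟨i, rfl⟩ : ∃ i, j = i + 1 := ⟨j - 1, by omega⟩
      simp only [Nat.add_sub_cancel] at this ⊢
      ring_nf at this ⊢
      linarith
    · subst hk
      rw [if_neg (lt_irrefl _), add_zero] at ih
      rw [if_pos (by omega), if_pos rfl, Nat.add_sub_cancel]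
      have h1 := mul_le_mul_of_nonneg_left ih hl'
      have h2 := mul_le_mul_of_nonneg_left ih hd
      -- The part of the excess coming from the fixed point `c r` is nonnegative and is discarded.
      have h3 : 0 ≤ (l - l') * (c * r) := by positivity
      ring_nf at h1 h2 h3 ⊢
      linarith
    · rw [if_neg (by omega)] at ih
      rw [if_neg (by omega), if_neg (by omega)]
      have := mul_le_mul_of_nonneg_left ih hl'
      ring_nf at this ⊢
      linarith

namespace Params

variable (p : Params)

/-! ### One epoch of SGLD on the two databases -/

theorem xh_pos : 0 < p.xh := p.xl_pos.trans p.xl_lt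

theorem three_le_sq_mul : 3 ≤ p.xh ^ 2 * p.β := by
  have h := p.β_ge
  have := p.xh_pos
  rw [div_le_iff₀ (by positivity)] at h
  linarith

theorem β_pos : 0 < p.β := by
  have := p.xh_pos
  exact lt_of_lt_of_le (by positivity) p.β_ge

/-- The precision `α + n x_h² β` of the posterior of `n` records with covariate `x_h`. -/
def precision (n : ℕ) : ℝ := p.α + n * p.xh ^ 2 * p.β

theorem three_mul_le_precision (n : ℕ) : 3 * (n : ℝ) ≤ p.precision n := by
  have h := mul_le_mul_of_nonneg_left p.three_le_sq_mul (Nat.cast_nonneg (α := ℝ) n)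
  have := p.α_pos
  unfold precision
  linarith

theorem precision_pos (n : ℕ) : 0 < p.precision n := by
  have := p.α_pos
  have := p.β_pos
  unfold precision
  positivity

/-- The proportion of the precision that comes from the prior. -/
def priorWeight (n : ℕ) : ℝ := p.α / p.precision n

theorem priorWeight_nonneg (n : ℕ) : 0 ≤ p.priorWeight n :=
  div_nonneg p.α_pos.le (p.precision_pos n).le

theorem one_sub_priorWeight (n : ℕ) :
    1 - p.priorWeight n = n * (p.xh ^ 2 * p.β) / p.precision n := by
  rw [priorWeight, eq_div_iff (p.precision_pos n).ne', sub_mul,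
    div_mul_cancel₀ _ (p.precision_pos n).ne', precision]
  ring

theorem priorWeight_le_one (n : ℕ) : p.priorWeight n ≤ 1 := by
  have h : 0 ≤ 1 - p.priorWeight n := by
    rw [one_sub_priorWeight]
    have := p.β_pos
    have := p.precision_pos n
    positivity
  linarith

/-- The shrinkage of an SGLD step on a record with covariate `x_h`. -/
def fullShrinkage (n : ℕ) : ℝ := 1 / (2 * p.precision n)

/-- The difference between the shrinkages for the covariates `x_h` and `x_h / 2`. -/
def shrinkageGap (n : ℕ) : ℝ := 3 / 8 * ((1 - p.priorWeight n) / p.precision n)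

theorem stepSize_eq (n : ℕ) : p.stepSize n = 1 / p.precision n ^ 2 := rfl

theorem stepSize_mul_α (n : ℕ) :
    p.stepSize n / 2 * p.α = p.fullShrinkage n * p.priorWeight n := by
  rw [stepSize_eq, fullShrinkage, priorWeight]
  have := (p.precision_pos n).ne'
  field_simp

theorem shrinkage_xh (n : ℕ) :
    shrinkage p.α p.β (p.stepSize n) n p.xh = p.fullShrinkage n := by
  have h : p.α + n * p.β * p.xh ^ 2 = p.precision n := by unfold precision; ring
  rw [shrinkage, h, stepSize_eq, fullShrinkage]
  have := (p.precision_pos n).ne'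
  field_simp

theorem shrinkage_half_xh (n : ℕ) :
    shrinkage p.α p.β (p.stepSize n) n (p.xh / 2) = p.fullShrinkage n - p.shrinkageGap n := by
  rw [← shrinkage_xh, shrinkageGap, one_sub_priorWeight, shrinkage, shrinkage, stepSize_eq]
  have := (p.precision_pos n).ne'
  field_simp
  ring

theorem shrinkageGap_nonneg (n : ℕ) : 0 ≤ p.shrinkageGap n := by
  have h1 := p.priorWeight_le_one n
  have h2 : 0 ≤ (1 - p.priorWeight n) / p.precision n :=
    div_nonneg (by linarith) (p.precision_pos n).le
  unfold shrinkageGap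
  positivity

/-- This is where `β ≥ 3 / x_h ^ 2` acts: the precision is at least `3 n`, so a whole epoch removes
only a bounded fraction of the initial deviation. -/
theorem fullShrinkage_le (n : ℕ) : n * p.fullShrinkage n ≤ 1 / 6 := by
  have h := p.three_mul_le_precision n
  have h0 := p.precision_pos n
  rw [fullShrinkage, mul_one_div, div_le_iff₀ (by positivity)]
  linarith

theorem fullShrinkage_nonneg (n : ℕ) : 0 ≤ p.fullShrinkage n := by
  have h0 := p.precision_pos n
  unfold fullShrinkage
  positivity

theorem fullShrinkage_le_one {n : ℕ} (hn : 0 < n) : p.fullShrinkage n ≤ 1 := by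
  have h := p.fullShrinkage_le n
  have h1 : (1 : ℝ) ≤ n := by exact_mod_cast hn
  have h2 := mul_le_mul_of_nonneg_right h1 (p.fullShrinkage_nonneg n)
  linarith

theorem natCast_mul_stepSize_le {n : ℕ} (hn : 0 < n) : n * p.stepSize n ≤ 1 := by
  have h := p.three_mul_le_precision n
  have h1 : (1 : ℝ) ≤ n := by exact_mod_cast hn
  have h0 := p.precision_pos n
  rw [stepSize_eq, mul_one_div, div_le_one (by positivity)]
  nlinarith

theorem stepSize_nonneg (n : ℕ) : 0 ≤ p.stepSize n := by
  rw [stepSize_eq]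
  positivity

/-- The expectation of the SGLD iterate after an epoch on `n` records of slope `c` and
covariate `x_h`. -/
def epochMean (c : ℝ) (n : ℕ) : ℝ :=
  c - c * (p.priorWeight n + (1 - p.priorWeight n) * (1 - p.fullShrinkage n) ^ n)

/-- A lower bound for the difference of the expectations after an epoch that is caused by a single
record with covariate `x_h / 2`. -/
def meanGap (c : ℝ) (n : ℕ) : ℝ :=
  (1 - p.fullShrinkage n) ^ (n - 1) * (p.shrinkageGap n * (c * (1 - p.priorWeight n)))

theorem half_le_sgldLaw {n : ℕ} (hn : 0 < n) (c : ℝ) {D : Database n}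
    (hD : ∀ i, D i = (p.xh, c * p.xh)) :
    ENNReal.ofReal (1 / 2) ≤
      sgldLaw p.α p.β (p.stepSize n) (fun i : (Finset.univ : Finset (Fin n)) => D i) n
        (Set.Ici (p.epochMean c n)) := by
  refine le_sgldLaw fun σ => ?_
  have hcard : Fintype.card (Finset.univ : Finset (Fin n)) = n := by simp
  obtain ⟨v, -, hlaw⟩ := cyclicSGLDLaw_eq_gaussianReal (c := c) (by rw [hcard]; exact hn)
    p.α_pos (p.stepSize_nonneg n) (fun i : (Finset.univ : Finset (Fin n)) => D i)
    (fun i => by rw [hD]) σ (fun _ => p.fullShrinkage n)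
    (fun j => by rw [hD, hcard, shrinkage_xh])
    (fun _ => p.fullShrinkage_nonneg n) (fun _ => p.fullShrinkage_le_one hn) n
  rw [hlaw, sgldError_const (p.stepSize_mul_α n)]
  rw [ENNReal.ofReal_le_iff_le_toReal (measure_ne_top _ _)]
  exact half_le_gaussianReal_Ici _ _

theorem meanGap_nonneg {c : ℝ} (hc : 0 ≤ c) {n : ℕ} (hn : 0 < n) : 0 ≤ p.meanGap c n := by
  have h1 := p.fullShrinkage_le_one hn
  have h2 := p.priorWeight_le_one n
  exact mul_nonneg (pow_nonneg (by linarith) _) (mul_nonneg (p.shrinkageGap_nonneg n)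
    (mul_nonneg hc (by linarith)))

theorem sgldLaw_le_exp {n : ℕ} (hn : 0 < n) {c : ℝ} (hc : 0 ≤ c) {D : Database n}
    (hD : ∀ i : Fin n, D i =
      if (i : ℕ) + 1 = n then (p.xh / 2, c * (p.xh / 2)) else (p.xh, c * p.xh)) :
    sgldLaw p.α p.β (p.stepSize n) (fun i : (Finset.univ : Finset (Fin n)) => D i) n
        (Set.Ici (p.epochMean c n)) ≤
      ENNReal.ofReal (Real.exp (-(p.meanGap c n ^ 2 / (2 * (p.α⁻¹ + 1))))) := by
  refine sgldLaw_le fun σ => ?_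
  have hcard : Fintype.card (Finset.univ : Finset (Fin n)) = n := by simp
  have hpos : 0 < Fintype.card (Finset.univ : Finset (Fin n)) := by rw [hcard]; exact hn
  have hslope : ∀ i, (D i).2 = c * (D i).1 := fun i => by
    rw [hD]
    split_ifs <;> rfl
  have hgap := p.shrinkageGap_nonneg n
  have hshr : ∀ i, shrinkage p.α p.β (p.stepSize n) n (D i).1 =
      if (i : ℕ) + 1 = n then p.fullShrinkage n - p.shrinkageGap n else p.fullShrinkage n := by
    intro i
    rw [hD]
    split_ifs
    · exact p.shrinkage_half_xh n
    · exact p.shrinkage_xh n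
  set s : ℕ → ℝ := fun j => shrinkage p.α p.β (p.stepSize n)
    (Fintype.card (Finset.univ : Finset (Fin n))) (D (σ ⟨j % _, Nat.mod_lt j hpos⟩)).1 with hs
  have hs0 : ∀ j, 0 ≤ s j := fun j => by
    have := p.stepSize_nonneg n
    have := p.α_pos
    have := p.β_pos
    simp only [hs, shrinkage]
    positivity
  have hs1 : ∀ j, s j ≤ 1 := fun j => by
    have := p.fullShrinkage_le_one hn
    simp only [hs, hcard, hshr]
    split_ifs <;> linarith
  obtain ⟨v, hv, hlaw⟩ := cyclicSGLDLaw_eq_gaussianReal (c := c) hpos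
    p.α_pos (p.stepSize_nonneg n) (fun i : (Finset.univ : Finset (Fin n)) => D i)
    (fun i => hslope i) σ s (fun j => rfl) hs0 hs1 n
  let last : (Finset.univ : Finset (Fin n)) := ⟨⟨n - 1, by omega⟩, Finset.mem_univ _⟩
  have herr := le_sgldError (c := c) (s := s) (n := n) (k := (σ.symm last : ℕ))
    (l' := p.fullShrinkage n - p.shrinkageGap n)
    (p.stepSize_mul_α n) hc (p.priorWeight_nonneg n) (p.priorWeight_le_one n)
    (p.fullShrinkage_le_one hn) (by linarith) (fun j hj => by
      -- Within the first epoch `j % n = j`, so the exceptional record is used exactly once, at its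
      -- position in the order.
      have hiff : (((σ ⟨j % _, Nat.mod_lt j hpos⟩ : (Finset.univ : Finset (Fin n))) : Fin n) : ℕ)
          + 1 = n ↔ j = (σ.symm last : ℕ) := by
        have h1 : (⟨j % _, Nat.mod_lt j hpos⟩ : Fin (Fintype.card _)) = σ.symm last ↔
            j = (σ.symm last : ℕ) := by
          rw [Fin.ext_iff]
          simp only [hcard, Nat.mod_eq_of_lt hj]
        rw [← h1, Equiv.eq_symm_apply, Subtype.ext_iff, Fin.ext_iff]
        simp only [last]
        omega
      simp only [hs, hcard, hshr] at hiff ⊢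
      simp only [hiff]) n le_rfl
  rw [if_pos (by have := (σ.symm last).2; omega)] at herr
  have hαinv := inv_pos.2 p.α_pos
  have htail := gaussianReal_Ici_le (m := c - sgldError p.α (p.stepSize n) c s n)
    (a := p.epochMean c n) (d := p.meanGap c n) (V := p.α⁻¹ + 1) (v := v)
    (p.meanGap_nonneg hc hn) (by linarith)
    (hv.trans (by linarith [p.natCast_mul_stepSize_le hn])) (by
      unfold epochMean meanGap
      rw [sub_sub_cancel] at herr
      linarith)
  rw [hlaw]
  exact (ENNReal.le_ofReal_iff_toReal_le (measure_ne_top _ _) (Real.exp_pos _).le).2 htail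

/-- The constant in the lower bound for `meanGap`. -/
def gapConstant : ℝ := 3 / (128 * (p.xh ^ 2 * p.β))

theorem gapConstant_pos : 0 < p.gapConstant := by
  have := p.three_le_sq_mul
  unfold gapConstant
  positivity

/-- The hypothesis on `α` says that the data outweigh the prior: the prior weight is at most `1/2`
and the precision at most `2 n x_h ^ 2 β`. Bernoulli's inequality keeps the power above `1/2`, and
the shrinkage gap is of order `1/n`. -/
theorem le_meanGap {c : ℝ} (hc : 0 ≤ c) {n : ℕ} (hn : 0 < n)
    (hα : p.α ≤ n * (p.xh ^ 2 * p.β)) : p.gapConstant * (c / n) ≤ p.meanGap c n := by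
  have hB := p.three_le_sq_mul
  set B := p.xh ^ 2 * p.β with hBdef
  have hA := p.precision_pos n
  have hn' : (0 : ℝ) < n := by exact_mod_cast hn
  have hAB : p.precision n = p.α + n * B := by unfold precision; rw [hBdef]; ring
  have h1 : 1 / 2 ≤ 1 - p.priorWeight n := by
    rw [one_sub_priorWeight, ← hBdef, le_div_iff₀ hA, hAB]
    linarith
  have h2 : 1 / 2 ≤ (1 - p.fullShrinkage n) ^ (n - 1) := by
    have h := one_add_mul_le_pow (a := -p.fullShrinkage n)
      (by linarith [p.fullShrinkage_le_one hn]) (n - 1)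
    have h3 := p.fullShrinkage_le n
    have h4 := p.fullShrinkage_nonneg n
    have h5 : ((n - 1 : ℕ) : ℝ) ≤ n := by exact_mod_cast Nat.sub_le n 1
    have h6 := mul_le_mul_of_nonneg_right h5 h4
    rw [← sub_eq_add_neg] at h
    linarith
  have h3 : 3 / (32 * (n * B)) ≤ p.shrinkageGap n := by
    unfold shrinkageGap
    have h4 : 1 / 2 / (2 * (n * B)) ≤ (1 - p.priorWeight n) / p.precision n := by
      gcongr
      rw [hAB]
      linarith
    have h5 : 3 / (32 * (n * B)) = 3 / 8 * (1 / 2 / (2 * (n * B))) := by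
      field_simp
      norm_num
    rw [h5]
    gcongr
  calc p.gapConstant * (c / n) = 1 / 2 * (3 / (32 * (n * B)) * (c * (1 / 2))) := by
        unfold gapConstant
        rw [← hBdef]
        field_simp
        ring
    _ ≤ p.meanGap c n := by
        unfold meanGap
        have := p.shrinkageGap_nonneg n
        gcongr

end Params

/-! ### Laplace tails and total masses -/

theorem stdLaplace_Ici_le {t : ℝ} (ht : 0 ≤ t) :
    stdLaplace (Set.Ici t) ≤ ENNReal.ofReal (Real.exp (-t)) := by
  rw [stdLaplace, withDensity_apply _ measurableSet_Ici, ← integral_exp_neg_Ioi,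
    ← integral_Ici_eq_integral_Ioi,
    ofReal_integral_eq_lintegral_ofReal ((integrableOn_exp_neg_Ioi t).congr_set_ae
      Ioi_ae_eq_Ici.symm) (Eventually.of_forall fun x => (Real.exp_pos _).le)]
  refine setLIntegral_mono (by fun_prop) fun x hx => ENNReal.ofReal_le_ofReal ?_
  rw [abs_of_nonneg (ht.trans hx)]
  have := Real.exp_pos (-x)
  linarith

instance : IsProbabilityMeasure Params.testNoise := by
  unfold Params.testNoise
  infer_instance

theorem isProbabilityMeasure_cyclicSGLDLaw {ι : Type} [Fintype ι] (α β η : ℝ) (d : ι → ℝ × ℝ)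
    (σ : Fin (Fintype.card ι) ≃ ι) (j : ℕ) :
    IsProbabilityMeasure (cyclicSGLDLaw α β η d σ j) := by
  induction j with
  | zero => rw [cyclicSGLDLaw]; infer_instance
  | succ j ih =>
    rw [cyclicSGLDLaw]
    have hm : Measurable (sgldDrift α β η d σ j) := by
      unfold sgldDrift
      simp only [deriv_logPrior, deriv_logLikelihood]
      split_ifs <;> fun_prop
    have := Measure.isProbabilityMeasure_map (μ := cyclicSGLDLaw α β η d σ j) hm.aemeasurable
    infer_instance

theorem sgldLaw_le_one {ι : Type} [Fintype ι] (α β η : ℝ) (d : ι → ℝ × ℝ) (T : ℕ) (S : Set ℝ) :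
    sgldLaw α β η d T S ≤ 1 :=
  sgldLaw_le fun σ => by
    have := isProbabilityMeasure_cyclicSGLDLaw α β η d σ T
    exact prob_le_one

namespace Params

variable (p : Params)

theorem offset_nonneg : 0 ≤ p.offset := by
  have h1 := p.ε_pos
  have h2 := p.δ_pos
  have h3 := p.δ_lt
  have : 0 ≤ Real.log (1 / (2 * p.δ)) := by
    apply Real.log_nonneg
    rw [le_div_iff₀ (by positivity)]
    linarith
  unfold offset
  positivity

theorem ν_pos : 0 < p.ν := by
  have h1 := p.ε_pos
  have h2 := p.δ_pos
  have h3 := p.δ_lt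
  have : 0 ≤ Real.log (1 / p.δ) := by
    apply Real.log_nonneg
    rw [le_div_iff₀ (by positivity)]
    linarith
  unfold ν
  positivity

theorem κ₁_pos : 0 < p.κ₁ := by
  have h1 := p.β_pos
  have h2 := p.α_pos
  have h3 := p.xh_pos
  have h4 := p.xl_pos
  unfold κ₁
  positivity

theorem κ₂_pos : 0 < p.κ₂ := by
  have h1 := p.β_pos
  have h2 := p.α_pos
  have h3 := p.xh_pos
  have h4 := p.xl_pos
  unfold κ₂
  positivity

/-! ### Measurability of the test phase -/

theorem measurable_nMin (n : ℕ) : Measurable (p.nMin n) := by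
  unfold nMin nb1
  fun_prop

/-- The output law depends on the noise only through this discrete-valued map, so its measurability
is what allows `Measure.bind` to be evaluated as an integral. -/
theorem measurable_testPhase {n : ℕ} (D : Database n) :
    @Measurable (Fin 4 → ℝ) (Option (Finset (Fin n))) _ ⊤ (p.testPhase D) := by
  let _ : MeasurableSpace (Finset (Fin n)) := ⊤
  let _ : MeasurableSpace (Option (Finset (Fin n))) := ⊤
  have hb : Measurable fun ℓ : Fin 4 → ℝ => p.slopeBound n (ℓ 0) := by
    unfold slopeBound nBreve
    fun_prop
  have hV : Measurable fun ℓ : Fin 4 → ℝ => V D (p.slopeBound n (ℓ 0)) := by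
    refine measurable_to_countable' fun s => ?_
    have h : (fun ℓ : Fin 4 → ℝ => V D (p.slopeBound n (ℓ 0))) ⁻¹' {s} =
        ⋂ i, {ℓ | (D i).2 / (D i).1 ≤ p.slopeBound n (ℓ 0) ↔ i ∈ s} := by
      ext ℓ
      simp [Finset.ext_iff, V]
    rw [h]
    exact MeasurableSet.iInter fun i =>
      (measurableSet_le measurable_const hb).iff (MeasurableSet.const _)
  have hn₂ : Measurable fun ℓ : Fin 4 → ℝ =>
      p.noisyCard (V D (p.slopeBound n (ℓ 0))) (ℓ 1) := by
    have : Measurable fun ℓ : Fin 4 → ℝ => ((V D (p.slopeBound n (ℓ 0))).card : ℝ) :=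
      (measurable_from_top (f := fun s : Finset (Fin n) => (s.card : ℝ))).comp hV
    unfold noisyCard
    fun_prop
  have hm : Measurable fun ℓ : Fin 4 → ℝ => slope D (V D (p.slopeBound n (ℓ 0))) +
      p.slopeScale (p.slopeBound n (ℓ 0)) (p.noisyCard (V D (p.slopeBound n (ℓ 0))) (ℓ 1)) *
        ℓ 2 := by
    have : Measurable fun ℓ : Fin 4 → ℝ => slope D (V D (p.slopeBound n (ℓ 0))) :=
      (measurable_from_top (f := fun s : Finset (Fin n) => slope D s)).comp hV
    unfold slopeScale
    fun_prop
  have hW : Measurable fun ℓ : Fin 4 → ℝ => p.W D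
      (p.noisyCard (V D (p.slopeBound n (ℓ 0))) (ℓ 1))
      (slope D (V D (p.slopeBound n (ℓ 0))) +
        p.slopeScale (p.slopeBound n (ℓ 0)) (p.noisyCard (V D (p.slopeBound n (ℓ 0))) (ℓ 1)) *
          ℓ 2) := by
    refine measurable_to_countable' fun s => ?_
    have h : ∀ f g : (Fin 4 → ℝ) → ℝ, (fun ℓ : Fin 4 → ℝ => p.W D (f ℓ) (g ℓ)) ⁻¹' {s} =
        ⋂ i, {ℓ | |(D i).2 / (D i).1 - g ℓ| ≤ (f ℓ) ^ p.ρ₂ ↔ i ∈ s} := by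
      intro f g
      ext ℓ
      simp [Finset.ext_iff, W]
    rw [h]
    refine MeasurableSet.iInter fun i => MeasurableSet.iff ?_ (MeasurableSet.const _)
    exact measurableSet_le (measurable_abs.comp (measurable_const.sub hm)) (hn₂.pow_const _)
  have hn₃ : Measurable fun ℓ : Fin 4 → ℝ => p.noisyCard (p.W D
      (p.noisyCard (V D (p.slopeBound n (ℓ 0))) (ℓ 1))
      (slope D (V D (p.slopeBound n (ℓ 0))) +
        p.slopeScale (p.slopeBound n (ℓ 0)) (p.noisyCard (V D (p.slopeBound n (ℓ 0))) (ℓ 1)) *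
          ℓ 2)) (ℓ 3) := by
    have := (measurable_from_top (f := fun s : Finset (Fin n) => (s.card : ℝ))).comp hW
    exact (this.sub_const _).add ((measurable_pi_apply 3).const_mul _)
  unfold testPhase
  exact Measurable.ite (measurableSet_le hn₂ measurable_const) measurable_const
    (Measurable.ite (measurableSet_lt hn₃ ((p.measurable_nMin n).comp hm)) measurable_const
      ((measurable_from_top (f := fun s : Finset (Fin n) => some s)).comp hW))

theorem measurableSet_testPhase_eq {n : ℕ} (D : Database n) (t : Option (Finset (Fin n))) :
    MeasurableSet {ℓ | p.testPhase D ℓ = t} := by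
  let _ : MeasurableSpace (Option (Finset (Fin n))) := ⊤
  exact (p.measurable_testPhase D) (MeasurableSet.of_discrete (s := {t}))

/-! ### The test phase on records with a common slope -/

/-- The noisy count of the empty set is at most `ℓ 3 / ε`, because the offset is nonnegative, and it
must reach the term `n ^ (ρ₂ / γ₁)` of `nMin`. -/
theorem testNoise_testPhase_eq_some_empty_le {n : ℕ} (D : Database n) :
    testNoise {ℓ | p.testPhase D ℓ = some ∅} ≤
      ENNReal.ofReal (Real.exp (-(p.ε * (n : ℝ) ^ (p.ρ₂ / p.γ₁)))) := by
  have hε := p.ε_pos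
  have hsub : {ℓ | p.testPhase D ℓ = some ∅} ⊆
      (fun ℓ : Fin 4 → ℝ => ℓ 3) ⁻¹' Set.Ici (p.ε * (n : ℝ) ^ (p.ρ₂ / p.γ₁)) := by
    intro ℓ hℓ
    simp only [Set.mem_ofPred_eq, testPhase] at hℓ
    split_ifs at hℓ with h1 h2
    rw [Option.some_inj] at hℓ
    rw [hℓ, not_lt] at h2
    have h3 := ((le_max_right _ _).trans (le_max_right _ _)).trans h2
    have h4 := p.offset_nonneg
    simp only [noisyCard, Finset.card_empty, Nat.cast_zero] at h3
    have h5 : (n : ℝ) ^ (p.ρ₂ / p.γ₁) ≤ 1 / p.ε * ℓ 3 := by linarith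
    rw [one_div_mul_eq_div, le_div_iff₀ hε] at h5
    simp only [Set.mem_preimage, Set.mem_Ici]
    linarith
  refine (measure_mono hsub).trans ?_
  have hmp : MeasurePreserving (fun ℓ : Fin 4 → ℝ => ℓ 3) testNoise stdLaplace :=
    measurePreserving_eval (fun _ : Fin 4 => stdLaplace) 3
  rw [hmp.measure_preimage measurableSet_Ici.nullMeasurableSet]
  exact stdLaplace_Ici_le (by positivity)

theorem W_eq_univ_or_empty {n : ℕ} {D : Database n} {c : ℝ} (hD : ∀ i, (D i).2 / (D i).1 = c)
    (n₂ m : ℝ) : p.W D n₂ m = Finset.univ ∨ p.W D n₂ m = ∅ := by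
  by_cases h : |c - m| ≤ n₂ ^ p.ρ₂
  · exact Or.inl (by simp [W, hD, h])
  · exact Or.inr (by simp [W, hD, h])

theorem testPhase_cases {n : ℕ} {D : Database n} {c : ℝ} (hD : ∀ i, (D i).2 / (D i).1 = c)
    (ℓ : Fin 4 → ℝ) : p.testPhase D ℓ = none ∨ p.testPhase D ℓ = some Finset.univ ∨
      p.testPhase D ℓ = some ∅ := by
  simp only [testPhase]
  split_ifs
  · exact Or.inl rfl
  · exact Or.inl rfl
  · rcases p.W_eq_univ_or_empty hD _ _ with h | h
    · exact Or.inr (Or.inl (congrArg some h))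
    · exact Or.inr (Or.inr (congrArg some h))

/-! ### The law of the output of the algorithm -/

/-- The law of the output of the algorithm on the clipped database `D`, given the result of the
test phase. -/
def sampleLaw {n : ℕ} (T : ℕ) (D : Database n) : Option (Finset (Fin n)) → Measure (Unit ⊕ ℝ)
  | none => Measure.dirac (Sum.inl ())
  | some W => (sgldLaw p.α p.β (p.stepSize n) (fun i : W => D i) T).map Sum.inr

theorem sampleLaw_none_inr_image {n : ℕ} (T : ℕ) (D : Database n) {S : Set ℝ}
    (hS : MeasurableSet S) : p.sampleLaw T D none (Sum.inr '' S) = 0 := by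
  rw [sampleLaw, Measure.dirac_apply' _ (measurableSet_inr_image.2 hS)]
  simp

theorem sampleLaw_some_inr_image {n : ℕ} (T : ℕ) (D : Database n) (W : Finset (Fin n))
    {S : Set ℝ} (hS : MeasurableSet S) : p.sampleLaw T D (some W) (Sum.inr '' S) =
      sgldLaw p.α p.β (p.stepSize n) (fun i : W => D i) T S := by
  rw [sampleLaw, Measure.map_apply measurable_inr (measurableSet_inr_image.2 hS),
    Set.preimage_image_eq _ Sum.inr_injective]

theorem sampleLaw_inr_image_le_one {n : ℕ} (T : ℕ) (D : Database n)
    (t : Option (Finset (Fin n))) {S : Set ℝ} (hS : MeasurableSet S) :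
    p.sampleLaw T D t (Sum.inr '' S) ≤ 1 := by
  cases t with
  | none => rw [sampleLaw_none_inr_image _ _ _ hS]; exact zero_le_one
  | some W => rw [sampleLaw_some_inr_image _ _ _ _ hS]; exact sgldLaw_le_one _ _ _ _ _ _

theorem sgldAlgorithm_apply {n : ℕ} (T : ℕ) (D : Database n) {S : Set (Unit ⊕ ℝ)}
    (hS : MeasurableSet S) : p.sgldAlgorithm T n D S =
      ∫⁻ ℓ, p.sampleLaw T (fun i => p.clip (D i)) (p.testPhase (fun i => p.clip (D i)) ℓ) S
        ∂testNoise := by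
  have hfun : p.sgldAlgorithm T n D = testNoise.bind fun ℓ =>
      p.sampleLaw T (fun i => p.clip (D i)) (p.testPhase (fun i => p.clip (D i)) ℓ) := by
    simp only [sgldAlgorithm]
    congr 1
  rw [hfun, Measure.bind_apply hS]
  let _ : MeasurableSpace (Option (Finset (Fin n))) := ⊤
  exact ((measurable_from_top (f := p.sampleLaw T (fun i => p.clip (D i)))).comp
    (p.measurable_testPhase _)).aemeasurable

theorem sgldAlgorithm_inr_image_ne_top {n : ℕ} (T : ℕ) (D : Database n) {S : Set ℝ}
    (hS : MeasurableSet S) : p.sgldAlgorithm T n D (Sum.inr '' S) ≠ ⊤ := by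
  rw [sgldAlgorithm_apply _ _ _ (measurableSet_inr_image.2 hS)]
  refine ne_top_of_le_ne_top ENNReal.one_ne_top ?_
  calc _ ≤ ∫⁻ _, 1 ∂testNoise := lintegral_mono fun ℓ => p.sampleLaw_inr_image_le_one _ _ _ hS
    _ = 1 := by simp

/-- Only the noise draws that give a full `W` are kept. -/
theorem le_sgldAlgorithm_real {n T : ℕ} {D : Database n} {S : Set ℝ} (hS : MeasurableSet S)
    {q : ℝ} (h : ENNReal.ofReal q ≤ sgldLaw p.α p.β (p.stepSize n)
      (fun i : (Finset.univ : Finset (Fin n)) => p.clip (D i)) T S) :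
    p.passProb D * q ≤ (p.sgldAlgorithm T n D).real (Sum.inr '' S) := by
  rw [measureReal_def, ← ENNReal.ofReal_le_iff_le_toReal (p.sgldAlgorithm_inr_image_ne_top T D hS),
    sgldAlgorithm_apply _ _ _ (measurableSet_inr_image.2 hS), passProb, measureReal_def,
    ENNReal.ofReal_mul ENNReal.toReal_nonneg, ENNReal.ofReal_toReal (measure_ne_top _ _), mul_comm,
    ← lintegral_indicator_const (p.measurableSet_testPhase_eq _ _)]
  refine lintegral_mono (Set.indicator_le fun ℓ hℓ => ?_)
  have hℓ : p.testPhase (fun i => p.clip (D i)) ℓ = some Finset.univ := hℓ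
  rw [hℓ, sampleLaw_some_inr_image _ _ _ _ hS]
  exact h

/-- Null contributes nothing to a set of real outputs and a full `W` contributes at most `q`. On the
rare event of an empty `W`, the SGLD mass is bounded by `1`. -/
theorem sgldAlgorithm_real_le {n T : ℕ} {D : Database n} {c : ℝ}
    (hD : ∀ i, (p.clip (D i)).2 / (p.clip (D i)).1 = c) {S : Set ℝ} (hS : MeasurableSet S)
    {q : ℝ} (hq : 0 ≤ q) (h : sgldLaw p.α p.β (p.stepSize n)
      (fun i : (Finset.univ : Finset (Fin n)) => p.clip (D i)) T S ≤ ENNReal.ofReal q) :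
    (p.sgldAlgorithm T n D).real (Sum.inr '' S) ≤
      q + Real.exp (-(p.ε * (n : ℝ) ^ (p.ρ₂ / p.γ₁))) := by
  refine ENNReal.toReal_le_of_le_ofReal (by positivity) ?_
  rw [sgldAlgorithm_apply _ _ _ (measurableSet_inr_image.2 hS),
    ENNReal.ofReal_add hq (Real.exp_pos _).le]
  set E := {ℓ | p.testPhase (fun i => p.clip (D i)) ℓ = some ∅} with hE
  calc _ ≤ ∫⁻ ℓ, (ENNReal.ofReal q + E.indicator (fun _ => 1) ℓ) ∂testNoise := by
        refine lintegral_mono fun ℓ => ?_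
        rcases p.testPhase_cases hD ℓ with ht | ht | ht
        · simp only [ht, sampleLaw_none_inr_image _ _ _ hS]
          exact zero_le
        · simp only [ht, sampleLaw_some_inr_image _ _ _ _ hS]
          exact h.trans le_self_add
        · have : ℓ ∈ E := ht
          simp only [Set.indicator_of_mem this]
          exact (p.sampleLaw_inr_image_le_one _ _ _ hS).trans le_add_self
    _ = ENNReal.ofReal q + testNoise E := by
        rw [lintegral_add_left measurable_const, lintegral_const, measure_univ, mul_one,
          lintegral_indicator_const (p.measurableSet_testPhase_eq _ _), one_mul]
    _ ≤ _ := by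
        gcongr
        exact p.testNoise_testPhase_eq_some_empty_le _

end Params

/-! ### Comparison of powers of a natural number -/

theorem eventually_mul_rpow_le (C : ℝ) {c a b : ℝ} (hc : 0 < c) (hab : a < b) :
    ∀ᶠ n : ℕ in atTop, C * (n : ℝ) ^ a ≤ c * (n : ℝ) ^ b := by
  have h := ((tendsto_rpow_atTop (sub_pos.2 hab)).comp
    (tendsto_natCast_atTop_atTop (R := ℝ))).eventually_ge_atTop (C / c)
  filter_upwards [h, eventually_gt_atTop 0] with n hn hpos
  have hn0 : (0 : ℝ) < n := by exact_mod_cast hpos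
  rw [Function.comp, div_le_iff₀ hc] at hn
  have h1 := mul_le_mul_of_nonneg_right hn (Real.rpow_nonneg hn0.le a)
  have h2 : (n : ℝ) ^ (b - a) * (n : ℝ) ^ a = (n : ℝ) ^ b := by
    rw [← Real.rpow_add hn0, sub_add_cancel]
  calc C * (n : ℝ) ^ a ≤ (n : ℝ) ^ (b - a) * c * (n : ℝ) ^ a := h1
    _ = c * ((n : ℝ) ^ (b - a) * (n : ℝ) ^ a) := by ring
    _ = c * (n : ℝ) ^ b := by rw [h2]

theorem eventually_mul_rpow_le_half (C : ℝ) {a : ℝ} (ha : a < 1) :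
    ∀ᶠ n : ℕ in atTop, C * (n : ℝ) ^ a ≤ n / 2 := by
  filter_upwards [eventually_mul_rpow_le C one_half_pos ha] with n hn
  rw [Real.rpow_one] at hn
  linarith

theorem eventually_le_half (C : ℝ) : ∀ᶠ n : ℕ in atTop, C ≤ n / 2 := by
  simpa using eventually_mul_rpow_le_half C zero_lt_one

namespace Params

variable (p : Params)

/-! ### The test phase is eventually passed -/

theorem nb1_le {m C : ℝ} (hm : 0 ≤ m)
    (h1 : 1 + p.xh ^ 2 / p.xl ^ 2 * (8 / p.ε) ≤ C)
    (h2 : 1 + p.ν * (p.xh ^ 2 / p.xl ^ 2) * (1 + 8 * ((p.ν - 1) / p.ε)) ≤ C)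
    (h3 : (16 * p.ν * p.β * p.xh ^ 4 / (9 / 10 * p.ε * p.xl ^ 2)) ^ (1 / (1 - 2 * p.γ₁)) ≤ C)
    (h4 : (32 * p.ν * p.β / p.ε * p.κ₁ * m) ^ (1 / (2 - p.γ₁)) ≤ C)
    (h5 : (32 * p.ν * p.β / p.ε * p.κ₁) ^ (1 / (2 - 2 * p.γ₁)) ≤ C)
    (h6 : (8 * p.ν / p.ε * p.κ₂ * m) ^ (2 / 3 : ℝ) ≤ C)
    (h7 : (8 * p.ν / p.ε * p.κ₂) ^ (1 / (3 - 2 * p.γ₁)) ≤ C) : p.nb1 m ≤ C := by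
  unfold nb1
  rw [max_eq_left hm]
  exact max_le h1 (max_le h2 (max_le h3 (max_le h4 (max_le h5 (max_le h6 h7)))))

theorem eventually_nMin_le {ρ₃ : ℝ} (hρ₃ : ρ₃ < 3 / 2) : ∀ᶠ n : ℕ in atTop, ∀ m : ℝ, 0 ≤ m →
    m ≤ 3 * (n : ℝ) ^ ρ₃ → p.nMin n m ≤ n / 2 := by
  have hν := p.ν_pos
  have hβ := p.β_pos
  have hε := p.ε_pos
  have hκ₁ := p.κ₁_pos
  have hκ₂ := p.κ₂_pos
  have hγ := p.γ₁_lt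
  have hγρ := p.γ₁_gt
  have hρ₂ := p.ρ₂_pos
  have hpow : ∀ K e : ℝ, 0 < K → 0 < e → ρ₃ * e < 1 → ∀ᶠ n : ℕ in atTop, ∀ m : ℝ, 0 ≤ m →
      m ≤ 3 * (n : ℝ) ^ ρ₃ → (K * m) ^ e ≤ n / 2 := by
    intro K e hK he hlt
    filter_upwards [eventually_mul_rpow_le_half ((K * 3) ^ e) hlt] with n hn m hm0 hm
    refine le_trans ?_ hn
    have h0 : (0 : ℝ) ≤ n := Nat.cast_nonneg n
    rw [Real.rpow_mul h0, ← Real.mul_rpow (by positivity) (by positivity)]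
    have h1 := mul_le_mul_of_nonneg_left hm hK.le
    exact Real.rpow_le_rpow (by positivity) (by linarith) he.le
  filter_upwards [eventually_le_half (1 + p.xh ^ 2 / p.xl ^ 2 * (8 / p.ε)),
    eventually_le_half (1 + p.ν * (p.xh ^ 2 / p.xl ^ 2) * (1 + 8 * ((p.ν - 1) / p.ε))),
    eventually_le_half
      ((16 * p.ν * p.β * p.xh ^ 4 / (9 / 10 * p.ε * p.xl ^ 2)) ^ (1 / (1 - 2 * p.γ₁))),
    -- The two terms containing `m` are sublinear in `n`: `ρ₃ < 3/2 < 2 - γ₁` here, and `2 ρ₃ / 3 <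
    -- 1` for the exponent `2/3`.
    hpow (32 * p.ν * p.β / p.ε * p.κ₁) (1 / (2 - p.γ₁)) (by positivity)
      (one_div_pos.2 (by linarith))
      (by rw [mul_one_div, div_lt_one (by linarith)]; linarith),
    eventually_le_half ((32 * p.ν * p.β / p.ε * p.κ₁) ^ (1 / (2 - 2 * p.γ₁))),
    hpow (8 * p.ν / p.ε * p.κ₂) (2 / 3) (by positivity) (by norm_num) (by linarith),
    eventually_le_half ((8 * p.ν / p.ε * p.κ₂) ^ (1 / (3 - 2 * p.γ₁))),
    eventually_le_half p.nb2,
    eventually_mul_rpow_le_half 1 (a := p.ρ₂ / p.γ₁) (by rw [div_lt_one (by linarith)]; exact hγρ)]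
    with n h1 h2 h3 h4 h5 h6 h7 h8 h9 m hm0 hm
  rw [one_mul] at h9
  exact max_le (p.nb1_le hm0 h1 h2 h3 (h4 m hm0 hm) h5 (h6 m hm0 hm) h7) (max_le h8 h9)

theorem slope_eq {n : ℕ} {D : Database n} {c : ℝ} (hD : ∀ i, (D i).2 = c * (D i).1)
    (hD' : ∀ i, (D i).1 ≠ 0) {s : Finset (Fin n)} (hs : s.Nonempty) : slope D s = c := by
  have hpos : 0 < ∑ i ∈ s, (D i).1 ^ 2 :=
    Finset.sum_pos (fun i _ => by have := hD' i; positivity) hs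
  rw [slope, div_eq_iff hpos.ne', Finset.mul_sum]
  exact Finset.sum_congr rfl fun i _ => by rw [hD]; ring

theorem abs_slopeScale_le {b n₂ : ℝ} (hb : 0 ≤ b) (hn₂ : 2 ≤ n₂) :
    |p.slopeScale b n₂| ≤
      1 / p.ε * ((2 * p.xh ^ 2 * p.xl ^ 2 + p.xh ^ 4) / p.xl ^ 4) * (b / n₂) := by
  have hε := p.ε_pos
  have hxl := p.xl_pos
  have h1 : 0 < n₂ - 1 := by linarith
  have h2 : 0 < n₂ := by linarith
  unfold slopeScale
  rw [abs_of_nonneg (by positivity)]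
  -- As `n₂ - 1 ≥ 1`, it can be factored out of the whole numerator and cancelled.
  have h3 : (2 * (n₂ - 1) * p.xh ^ 2 * p.xl ^ 2 + p.xh ^ 4) / (n₂ * (n₂ - 1) * p.xl ^ 4) ≤
      ((2 * p.xh ^ 2 * p.xl ^ 2 + p.xh ^ 4) * (n₂ - 1)) / (n₂ * (n₂ - 1) * p.xl ^ 4) := by
    gcongr
    have : p.xh ^ 4 * 1 ≤ p.xh ^ 4 * (n₂ - 1) := by
      gcongr
      linarith
    linarith
  calc _ ≤ 1 / p.ε * b *
        (((2 * p.xh ^ 2 * p.xl ^ 2 + p.xh ^ 4) * (n₂ - 1)) / (n₂ * (n₂ - 1) * p.xl ^ 4)) := by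
        gcongr
    _ = _ := by field_simp

/-- With the draws fixed, all noisy counts lie between `n / 2` and `2 n`. Then `ρ₃ < ρ₁` puts every
record in `V`. The slope noise is `O(n ^ (ρ₁ - 1))`, which `ρ₁ < 1 + ρ₂` makes smaller than the
width `n₂ ^ ρ₂` of the window for `W`. Finally `nMin` is at most `n / 2`. -/
theorem eventually_testPhase_eq {ρ₃ : ℝ} (hρ : p.ρ₁ < 1 + p.ρ₂) (hρ₃ : 1 < ρ₃)
    (hρ₃' : ρ₃ < p.ρ₁) (ℓ : Fin 4 → ℝ) (D : (n : ℕ) → Database n)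
    (hD : ∀ n i, (D n i).2 = (n : ℝ) ^ ρ₃ * (D n i).1) (hD' : ∀ n i, (D n i).1 ≠ 0) :
    ∀ᶠ n : ℕ in atTop, p.testPhase (D n) ℓ = some Finset.univ := by
  have hρ₂ := p.ρ₂_pos
  have hρ₂' := p.ρ₂_lt
  have hρ₁ := p.ρ₁_gt
  have hε := p.ε_pos
  have hxl := p.xl_pos
  have hadd : ∀ k : ℝ, ∀ᶠ n : ℕ in atTop,
      (n : ℝ) / 2 ≤ n - p.offset + k ∧ n - p.offset + k ≤ 2 * n := by
    intro k
    filter_upwards [eventually_le_half |k - p.offset|] with n hn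
    have := abs_le.1 hn
    constructor <;> linarith [Nat.cast_nonneg (α := ℝ) n]
  set K := 1 / p.ε * ((2 * p.xh ^ 2 * p.xl ^ 2 + p.xh ^ 4) / p.xl ^ 4) with hK
  have hK0 : 0 ≤ K := by positivity
  filter_upwards [hadd (1 / p.ε * ℓ 0), hadd (1 / p.ε * ℓ 1), hadd (1 / p.ε * ℓ 3),
    eventually_ge_atTop 4,
    eventually_mul_rpow_le 1 (c := (1 / 2) ^ p.ρ₁) (by positivity) hρ₃',
    eventually_mul_rpow_le (K * 2 ^ p.ρ₁ * 2 * |ℓ 2|) (c := (1 / 2) ^ p.ρ₂) (by positivity)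
      (show p.ρ₁ - 1 < p.ρ₂ by linarith),
    p.eventually_nMin_le (hρ₃'.trans p.ρ₁_lt)] with n h0 h1 h3 hn4 hV hW hmin
  have hn : (4 : ℝ) ≤ n := by exact_mod_cast hn4
  have hn0 : (0 : ℝ) < n := by linarith
  have : Nonempty (Fin n) := ⟨⟨0, by omega⟩⟩
  have hdiv : ∀ i, (D n i).2 / (D n i).1 = (n : ℝ) ^ ρ₃ := fun i => by
    rw [hD, mul_div_cancel_right₀ _ (hD' n i)]
  have hb0 : 0 ≤ p.nBreve n (ℓ 0) := by unfold nBreve; linarith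
  have hbl : (n : ℝ) ^ ρ₃ ≤ p.slopeBound n (ℓ 0) := by
    rw [one_mul, ← Real.mul_rpow (by norm_num) hn0.le] at hV
    refine hV.trans ?_
    unfold slopeBound
    rw [max_eq_left hb0]
    gcongr
    unfold nBreve
    linarith
  have hbu : p.slopeBound n (ℓ 0) ≤ 2 ^ p.ρ₁ * (n : ℝ) ^ p.ρ₁ := by
    rw [← Real.mul_rpow (by norm_num) hn0.le]
    unfold slopeBound
    rw [max_eq_left hb0]
    gcongr
    exact h0.2
  have hb : 0 ≤ p.slopeBound n (ℓ 0) := (by positivity : (0 : ℝ) ≤ (n : ℝ) ^ ρ₃).trans hbl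
  have hVuniv : V (D n) (p.slopeBound n (ℓ 0)) = Finset.univ := by
    simp [V, hdiv, hbl]
  have hn₂ : p.noisyCard (Finset.univ : Finset (Fin n)) (ℓ 1) =
      n - p.offset + 1 / p.ε * ℓ 1 := by simp [noisyCard]
  set n₂ := (n : ℝ) - p.offset + 1 / p.ε * ℓ 1 with hn₂def
  have hdev : |p.slopeScale (p.slopeBound n (ℓ 0)) n₂ * ℓ 2| ≤ n₂ ^ p.ρ₂ := by
    have hn₂pos : 0 < n₂ := by linarith
    calc |p.slopeScale (p.slopeBound n (ℓ 0)) n₂ * ℓ 2|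
        ≤ K * (p.slopeBound n (ℓ 0) / n₂) * |ℓ 2| := by
          rw [abs_mul]
          gcongr
          exact p.abs_slopeScale_le hb (by linarith)
      _ ≤ K * ((2 ^ p.ρ₁ * (n : ℝ) ^ p.ρ₁) / (n / 2)) * |ℓ 2| := by
          gcongr
          exact h1.1
      _ = K * 2 ^ p.ρ₁ * 2 * |ℓ 2| * (n : ℝ) ^ (p.ρ₁ - 1) := by
          rw [Real.rpow_sub hn0, Real.rpow_one]
          field_simp
      _ ≤ (1 / 2) ^ p.ρ₂ * (n : ℝ) ^ p.ρ₂ := hW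
      _ = (1 / 2 * n) ^ p.ρ₂ := by rw [Real.mul_rpow (by norm_num) hn0.le]
      _ ≤ n₂ ^ p.ρ₂ := by
          gcongr
          linarith
  -- This keeps the slope noise below `n ≤ n ^ ρ₃`, so the noisy slope is nonnegative and at most `2
  -- n ^ ρ₃`, as the bound on `nMin` requires.
  have hpow : n₂ ^ p.ρ₂ ≤ n := by
    refine (Real.rpow_le_rpow_of_exponent_le (by linarith) hρ₂'.le).trans ?_
    rw [← Real.sqrt_eq_rpow, Real.sqrt_le_left hn0.le]
    nlinarith
  have hnρ : (n : ℝ) ≤ (n : ℝ) ^ ρ₃ := by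
    conv_lhs => rw [← Real.rpow_one (n : ℝ)]
    exact Real.rpow_le_rpow_of_exponent_le (by linarith) hρ₃.le
  set e := p.slopeScale (p.slopeBound n (ℓ 0)) n₂ * ℓ 2 with he
  have hWuniv : p.W (D n) n₂ ((n : ℝ) ^ ρ₃ + e) = Finset.univ := by
    simp only [W, hdiv, sub_add_cancel_left, abs_neg]
    simp [hdev]
  have habs := abs_le.1 (hdev.trans hpow)
  have hpass := hmin ((n : ℝ) ^ ρ₃ + e) (by linarith [habs.1]) (by linarith [habs.2])
  have hn₃ : p.noisyCard (Finset.univ : Finset (Fin n)) (ℓ 3) =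
      n - p.offset + 1 / p.ε * ℓ 3 := by simp [noisyCard]
  simp only [testPhase, hVuniv, hn₂, slope_eq (hD n) (hD' n) Finset.univ_nonempty, ← he, hWuniv,
    hn₃]
  rw [if_neg (by linarith), if_neg (by linarith)]

theorem tendsto_passProb {ρ₃ : ℝ} (hρ : p.ρ₁ < 1 + p.ρ₂) (hρ₃ : 1 < ρ₃)
    (hρ₃' : ρ₃ < p.ρ₁) (D : (n : ℕ) → Database n)
    (hD : ∀ n i, (p.clip (D n i)).2 = (n : ℝ) ^ ρ₃ * (p.clip (D n i)).1) :
    Tendsto (fun n => p.passProb (D n)) atTop (𝓝 1) := by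
  have hne : ∀ n i, (p.clip (D n i)).1 ≠ 0 := fun n i =>
    (lt_min (p.xl_pos.trans_le (le_max_right _ _)) p.xh_pos).ne'
  -- The indicators of the passing events converge pointwise to `1`, and the noise law is finite and
  -- does not depend on `n`.
  have h := tendsto_measure_of_tendsto_indicator_of_isFiniteMeasure (L := atTop) testNoise
    (A := Set.univ)
    (As := fun n => {ℓ | p.testPhase (fun i => p.clip (D n i)) ℓ = some Finset.univ})
    (fun n => p.measurableSet_testPhase_eq _ _) (fun ℓ => by
      filter_upwards [p.eventually_testPhase_eq hρ hρ₃ hρ₃' ℓ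
        (fun n i => p.clip (D n i)) hD hne] with n hn
      simpa using hn)
  rw [measure_univ] at h
  have hreal := (ENNReal.tendsto_toReal ENNReal.one_ne_top).comp h
  rw [ENNReal.toReal_one] at hreal
  exact hreal

/-! ### The two databases -/

theorem clip_eq {x y : ℝ} (hx : p.xl ≤ x) (hx' : x ≤ p.xh) (hy : 0 ≤ y) :
    p.clip (x, y) = (x, y) := by
  simp [clip, hx, hx', hy]

theorem clip_D₃ (ρ₃ : ℝ) (n : ℕ) (i : Fin n) :
    p.clip (p.D₃ ρ₃ n i) = (p.xh, (n : ℝ) ^ ρ₃ * p.xh) :=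
  p.clip_eq p.xl_lt.le le_rfl (mul_nonneg (by positivity) p.xh_pos.le)

theorem clip_D₄ (hx : p.xl ≤ p.xh / 2) (ρ₃ : ℝ) (n : ℕ) (i : Fin n) :
    p.clip (p.D₄ ρ₃ n i) = if (i : ℕ) + 1 = n then (p.xh / 2, (n : ℝ) ^ ρ₃ * (p.xh / 2))
      else (p.xh, (n : ℝ) ^ ρ₃ * p.xh) := by
  have := p.xh_pos
  unfold D₄
  split_ifs
  · exact p.clip_eq hx (by linarith) (by positivity)
  · exact p.clip_D₃ ρ₃ n i

theorem hammingDist_D₃_D₄_le (ρ₃ : ℝ) (n : ℕ) : hammingDist (p.D₃ ρ₃ n) (p.D₄ ρ₃ n) ≤ 1 := by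
  unfold hammingDist
  rw [Finset.card_le_one]
  have h : ∀ i, p.D₃ ρ₃ n i ≠ p.D₄ ρ₃ n i → (i : ℕ) + 1 = n := fun i hi => by
    by_contra hne
    exact hi (by rw [D₄, if_neg hne])
  intro a ha b hb
  have h1 := h a (Finset.mem_filter.1 ha).2
  have h2 := h b (Finset.mem_filter.1 hb).2
  exact Fin.ext (by omega)

theorem exists_sgldAlgorithm_gap (hx : p.xl ≤ p.xh / 2) (hρ : p.ρ₁ < 1 + p.ρ₂)
    {ρ₃ : ℝ} (hρ₃ : 1 < ρ₃) (hρ₃' : ρ₃ < p.ρ₁) :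
    ∃ C : ℝ, 0 < C ∧ ∀ δ : ℝ, δ < 1 / 6 → ∀ᶠ n : ℕ in atTop,
      ∃ S : Set (Unit ⊕ ℝ), MeasurableSet S ∧
        Real.exp (C * (n : ℝ) ^ (2 * ρ₃ - 2)) *
            (p.sgldAlgorithm (max n 1) n (p.D₄ ρ₃ n)).real S + δ <
          (p.sgldAlgorithm (max n 1) n (p.D₃ ρ₃ n)).real S := by
  have hκ := p.gapConstant_pos
  have hα := inv_pos.2 p.α_pos
  -- Half of the Gaussian exponent: one half pays for the factor `exp(C n ^ (2 ρ₃ - 2))`, and the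
  -- other half still drives the product to `0`.
  set C := p.gapConstant ^ 2 / (2 * (p.α⁻¹ + 1)) / 2 with hC
  have hC0 : 0 < C := by positivity
  refine ⟨C, hC0, fun δ hδ => ?_⟩
  have hB : 0 < p.xh ^ 2 * p.β := by linarith [p.three_le_sq_mul]
  have hγ := p.γ₁_lt
  have hγρ := p.γ₁_gt
  have hρ₂ := p.ρ₂_pos
  have hexp : 2 * ρ₃ - 2 < p.ρ₂ / p.γ₁ := by
    rw [lt_div_iff₀ (by linarith)]
    nlinarith
  have hlim : Tendsto (fun n : ℕ => 2 * Real.exp (-(C * (n : ℝ) ^ (2 * ρ₃ - 2)))) atTop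
      (𝓝 0) := by
    have h1 : Tendsto (fun n : ℕ => C * (n : ℝ) ^ (2 * ρ₃ - 2)) atTop atTop :=
      ((tendsto_rpow_atTop (by linarith : 0 < 2 * ρ₃ - 2)).comp
        tendsto_natCast_atTop_atTop).const_mul_atTop hC0
    simpa using (Real.tendsto_exp_neg_atTop_nhds_zero.comp h1).const_mul 2
  have hpass := p.tendsto_passProb hρ hρ₃ hρ₃' (p.D₃ ρ₃) (fun n i => by rw [clip_D₃])
  -- The mass under `D₃` exceeds `2/3 * 1/2 = 1/3`, and the inflated mass under `D₄` is below `1/6`.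
  -- What remains is more than `1/6 > δ`.
  filter_upwards [eventually_gt_atTop 0, eventually_mul_rpow_le (2 * C) p.ε_pos hexp,
    hlim.eventually_lt_const (show (0 : ℝ) < 1 / 6 by norm_num),
    hpass.eventually_const_lt (show (2 / 3 : ℝ) < 1 by norm_num),
    eventually_le_half (p.α / (p.xh ^ 2 * p.β))] with n hn htail hsmall hpass hnα
  have hn0 : (0 : ℝ) < n := by exact_mod_cast hn
  have hT : max n 1 = n := max_eq_left hn
  rw [hT]
  set c := (n : ℝ) ^ ρ₃ with hc
  have hc0 : 0 ≤ c := by positivity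
  refine ⟨Sum.inr '' Set.Ici (p.epochMean c n), measurableSet_inr_image.2 measurableSet_Ici, ?_⟩
  have h3 := p.le_sgldAlgorithm_real (T := n) (D := p.D₃ ρ₃ n)
    (measurableSet_Ici (a := p.epochMean c n))
    (p.half_le_sgldLaw hn c (D := fun i => p.clip (p.D₃ ρ₃ n i)) (p.clip_D₃ ρ₃ n))
  have h4 := p.sgldAlgorithm_real_le (T := n) (D := p.D₄ ρ₃ n) (c := c) (fun i => by
      have := p.xh_pos
      rw [p.clip_D₄ hx]
      split_ifs
      · exact mul_div_cancel_right₀ _ (by positivity)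
      · exact mul_div_cancel_right₀ _ (by positivity))
    (measurableSet_Ici (a := p.epochMean c n)) (Real.exp_pos _).le
    (p.sgldLaw_le_exp hn hc0 (D := fun i => p.clip (p.D₄ ρ₃ n i)) (p.clip_D₄ hx ρ₃ n))
  set X := (n : ℝ) ^ (2 * ρ₃ - 2) with hX
  have hgap : 2 * (C * X) ≤ p.meanGap c n ^ 2 / (2 * (p.α⁻¹ + 1)) := by
    have h5 := p.le_meanGap hc0 hn (by
      rw [div_le_iff₀ hB] at hnα
      have : 0 < (n : ℝ) * (p.xh ^ 2 * p.β) := by positivity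
      linarith)
    have h6 : (c / n) ^ 2 = X := by
      rw [hc, hX, ← Real.rpow_sub_one hn0.ne', ← Real.rpow_natCast, ← Real.rpow_mul hn0.le]
      congr 1
      push_cast
      ring
    calc 2 * (C * X) = (p.gapConstant * (c / n)) ^ 2 / (2 * (p.α⁻¹ + 1)) := by
          rw [mul_pow, h6, hC]
          ring
      _ ≤ _ := by gcongr
  have h7 : (p.sgldAlgorithm n n (p.D₄ ρ₃ n)).real (Sum.inr '' Set.Ici (p.epochMean c n)) ≤
      2 * Real.exp (-(2 * (C * X))) := by
    have h8 : Real.exp (-(p.meanGap c n ^ 2 / (2 * (p.α⁻¹ + 1)))) ≤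
        Real.exp (-(2 * (C * X))) := Real.exp_le_exp.2 (neg_le_neg hgap)
    have h9 : Real.exp (-(p.ε * (n : ℝ) ^ (p.ρ₂ / p.γ₁))) ≤ Real.exp (-(2 * (C * X))) :=
      Real.exp_le_exp.2 (neg_le_neg (by linarith))
    linarith
  have h10 : Real.exp (C * X) * (2 * Real.exp (-(2 * (C * X)))) =
      2 * Real.exp (-(C * X)) := by
    rw [mul_left_comm, ← Real.exp_add]
    ring_nf
  have h11 := mul_le_mul_of_nonneg_left h7 (Real.exp_pos (C * X)).le
  linarith

end Params

end ProposeTestSample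

end

/-! ### The main theorem -/

theorem mainTheorem4 (p : ProposeTestSample.Params)
    (hx : p.xl ≤ p.xh / 2) (hρ : p.ρ₁ < 1 + p.ρ₂)
    (ρ₃ : ℝ) (hρ₃ : 1 < ρ₃) (hρ₃' : ρ₃ < p.ρ₁) :
    (∀ ε δ : ℝ, 0 < ε → δ < 1 / 6 → ∃ T : ℕ, 0 < T ∧
      ¬ ProposeTestSample.IsDifferentiallyPrivate (fun n₁ D => p.sgldAlgorithm T n₁ D) ε δ) ∧
    (∀ n₁ : ℕ, hammingDist (p.D₃ ρ₃ n₁) (p.D₄ ρ₃ n₁) ≤ 1) ∧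
    Tendsto (fun n₁ : ℕ => p.passProb (p.D₃ ρ₃ n₁)) atTop (𝓝 1) ∧
    Tendsto (fun n₁ : ℕ => p.passProb (p.D₄ ρ₃ n₁)) atTop (𝓝 1) ∧
    ∃ (C : ℝ) (T : ℕ → ℕ), 0 < C ∧ (∀ n₁, 0 < T n₁) ∧
      ∀ δ : ℝ, δ < 1 / 6 → ∀ᶠ n₁ : ℕ in atTop,
        ∃ S : Set (Unit ⊕ ℝ), MeasurableSet S ∧
          Real.exp (C * (n₁ : ℝ) ^ (2 * ρ₃ - 2)) *
              (p.sgldAlgorithm (T n₁) n₁ (p.D₄ ρ₃ n₁)).real S + δ <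
            (p.sgldAlgorithm (T n₁) n₁ (p.D₃ ρ₃ n₁)).real S := by
  obtain ⟨C, hC, hgap⟩ := p.exists_sgldAlgorithm_gap hx hρ hρ₃ hρ₃'
  refine ⟨fun ε δ _ hδ => ?_, p.hammingDist_D₃_D₄_le ρ₃,
    p.tendsto_passProb hρ hρ₃ hρ₃' (p.D₃ ρ₃) (fun n i => by rw [p.clip_D₃]),
    p.tendsto_passProb hρ hρ₃ hρ₃' (p.D₄ ρ₃) (fun n i => by
      rw [p.clip_D₄ hx]
      split_ifs <;> rfl),
    -- One epoch; the maximum only matters for `n = 0`, where the number of steps must still be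
    -- positive.
    C, fun n => max n 1, hC, fun n => by simp, hgap⟩
  -- Since `ρ₃ > 1`, the exponent outgrows any given `ε`. A single sufficiently large size `n` then
  -- fixes `T` and violates privacy.
  have hlarge : ∀ᶠ n : ℕ in atTop, ε ≤ C * (n : ℝ) ^ (2 * ρ₃ - 2) :=
    (((tendsto_rpow_atTop (by linarith : 0 < 2 * ρ₃ - 2)).comp
      tendsto_natCast_atTop_atTop).const_mul_atTop hC).eventually_ge_atTop ε
  obtain ⟨n, hn, S, hS, hlt⟩ := (hlarge.and (hgap δ hδ)).exists
  refine ⟨max n 1, by simp, fun hpriv => ?_⟩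
  have h := hpriv n _ _ (p.hammingDist_D₃_D₄_le ρ₃ n) S hS
  have h1 := mul_le_mul_of_nonneg_right (Real.exp_le_exp.2 hn)
    (measureReal_nonneg (μ := p.sgldAlgorithm (max n 1) n (p.D₄ ρ₃ n)) (s := S))
  linarith
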